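/- Let $\tau\in\mathbb C$ with $\operatorname{Im}\tau>0$, put $q=e^{i\pi\tau}$ (so $|q|<1$) and $q^{2/5}=e^{2i\pi\tau/5}$, and let $$R(q)=\cfrac{q^{2/5}}{1+\cfrac{q^{2}}{1+\cfrac{q^{4}}{1+\cfrac{q^{6}}{1+\cdots}}}}$$ be the Rogers–Ramanujan continued fraction. For $\operatorname{Im} t>0$ and $v\in\mathbb C$ let $\theta_4(v,t)=\sum_{n\in\mathbb Z}(-1)^n e^{i\pi n^2t}e^{2i\pi nv}$ and, for $p\ge1$, $$c_{2p}(t)=-\frac1p\sum_{k\ge0}\frac1{\bigl(\sin (k+\frac12)\pi t\bigr)^{2p}} .$$ Then the following hold. 1. The series defining $c_{2p}(5\tau)$ converges for every $p\ge1$, and these numbers are the coefficients of the expansion $$\theta_4(v,5\tau)=\theta_4(0,5\tau)\exp\Bigl[\sum_{p\ge1}c_{2p}(5\tau)(\sin\pi v)^{2p}\Bigr],$$ whose series converges absolutely whenever $|\sin\pi v|<|\sin (k+\frac12)5\pi\tau|$ for all integers $k\ge0$. 2. The continued fraction converges, $\theta_4(\frac{\tau}{2},5\tau)\neq0$, and $$R(q)=q^{2/5}\,\frac{\theta_4(\frac{3\tau}{2},5\tau)}{\theta_4(\frac{\tau}{2},5\tau)}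 .$$ 3. Suppose in addition that $\bigl|\sin\frac{\pi\tau}2\bigr|<\bigl|\sin (k+\frac12)5\pi\tau\bigr|$ and $\bigl|\sin\frac{3\pi\tau}2\bigr|<\bigl|\sin (k+\frac12)5\pi\tau\bigr|$ for all integers $k\ge0$. Then $$R(q)=\exp\Bigl[\frac{2i\pi\tau}{5}-\sum_{p\ge1}c_{2p}(5\tau)\Bigl(\bigl(\sin\tfrac{\pi\tau}2\bigr)^{2p}-\bigl(\sin\tfrac{3\pi\tau}2\bigr)^{2p}\Bigr)\Bigr]$$ $$=\exp\Bigl[\frac{2i\pi\tau}{5}+\sum_{p\ge1,\,k\ge0}\frac1p\,\frac{\bigl(\sin\frac{\pi\tau}2\bigr)^{2p}-\bigl(\sin\frac{3\pi\tau}2\bigr)^{2p}}{\bigl(\sin (k+\frac12)5\pi\tau\bigr)^{2p}}\Bigr],$$ and, in terms of $q$, $$R(q)=q^{2/5}\exp\Bigl[\sum_{p\ge1,\,k\ge0}\frac{q^{2p(5k+1)}}{p}\cdot\frac{(q^2-q)^{2p}-(q^3-1)^{2p}}{\bigl(q^{5(2k+1)}-1\bigr)^{2p}}\Bigr],$$ where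 all the series converge absolutely. -/

import Mathlib

open Filter Topology

namespace RogersRamanujan

noncomputable section

/-- The nome `q = e^{iπτ}`. -/
def nome (τ : ℂ) : ℂ := Complex.exp (Complex.I * Real.pi * τ)

/-- The fractional power `q^{2/5}`, understood as `e^{2πiτ/5}`. -/
def nomeTwoFifths (τ : ℂ) : ℂ := Complex.exp (Complex.I * Real.pi * (2 * τ / 5))

/-- The theta function `θ₄(v, τ) = ∑_{n ∈ ℤ} (-1)^n q^{n²} e^{2πinv}`, `q = e^{iπτ}`. -/
def theta4 (v τ : ℂ) : ℂ :=
  ∑' n : ℤ, (-1 : ℂ) ^ n * nome τ ^ (n ^ 2) * Complex.exp (2 * Real.pi * Complex.I * n * v)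

/-- The coefficient `c_{2p}(τ) = -(1/p) ∑_{k ≥ 0} 1 / (sin ((k + 1/2)πτ))^{2p}`, for `p ≥ 1`;
the argument is `p`, not `2p`. -/
def thetaCoeff (p : ℕ) (τ : ℂ) : ℂ :=
  -(1 / (p : ℂ)) * ∑' k : ℕ, 1 / Complex.sin (((k : ℂ) + 1 / 2) * Real.pi * τ) ^ (2 * p)

/-- The formal continued fraction
`q^{2/5} / (1 + q² / (1 + q⁴ / (1 + q⁶ / (1 + ⋯))))`, `q = e^{iπτ}`:
the integer part is `0`, the partial numerators are `q^{2/5}, q², q⁴, q⁶, …`,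
and all partial denominators are `1`. -/
def contFract (τ : ℂ) : GenContFract ℂ where
  h := 0
  s := Stream'.Seq.ofStream fun n : ℕ =>
    ⟨if n = 0 then nomeTwoFifths τ else nome τ ^ (2 * n), 1⟩

/-- The Rogers–Ramanujan continued fraction `R(q)`, `q = e^{iπτ}`: the limit of the convergents. -/
def R (τ : ℂ) : ℂ := limUnder atTop (contFract τ).convs

/-- The region `|sin πv| < |sin (k + 1/2)πτ|` for all `k ≥ 0`, in which each geometric ratio
`(sin πv / sin (k + 1/2)πτ)²` of the expansion of `log θ₄(v, τ)` has modulus less than `1`. -/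
def InStrip (v τ : ℂ) : Prop :=
  ∀ k : ℕ, ‖Complex.sin (Real.pi * v)‖ < ‖Complex.sin (((k : ℂ) + 1 / 2) * Real.pi * τ)‖

end

end RogersRamanujan

/-! With `x = q²`, the continuants of the fraction satisfy `c (n+2) = c (n+1) + x^(n+1) * c n`.
Schur solved this recurrence by the sums over `j ∈ ℤ` of `(-1)^j x^((5j² + (1-4s)j)/2)` times the
Gaussian binomial with top `n` and lower index `⌊(n - 5j)/2⌋ + s`: `s = 0` gives the denominators
and `s = 1` the numerators, up to the factor `q^{2/5}`. Pairing `j = 2i` with `j = 2i + 1` makes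
signs and exponents explicit, and the two Pascal rules then prove the recurrence
(`schurSum_add_two`). As `n → ∞` each Gaussian binomial tends to `1 / ∏ (1 - x^k)`, and by dominated
convergence the sums tend to `θ₄((1-4s)τ/2, 5τ)` divided by that product (`tendsto_schurSum_nome`).
The product cancels in the convergents, so the theta quotient appears without the Rogers–Ramanujan
identities.

The Jacobi triple product, obtained in the same way from a finite version (`tendsto_prod_theta4`),
shows that `θ₄(τ/2, 5τ) ≠ 0` and yields `θ₄(v,t) = θ₄(0,t) ∏ (1 - (sin πv / sin (k+½)πt)²)`. In the
given region the logarithm of this product is an absolutely convergent double series; summing over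
`k` first produces the `c_{2p}`, and subtracting its values at `v = τ/2` and `v = 3τ/2` gives the
expansions of `R`. -/

namespace RogersRamanujan

/-! ### Gaussian binomial coefficients and their limits. -/

/-- The Gaussian binomial coefficient `[n; a]` in base `x`, for an integer lower index `a`. -/
noncomputable def gaussBinom (x : ℂ) : ℕ → ℤ → ℂ
  | 0, a => if a = 0 then 1 else 0
  | n + 1, a => gaussBinom x n (a - 1) + x ^ a * gaussBinom x n a

/-- The finite product `(1 - x)(1 - x²)⋯(1 - xⁿ)`. -/
noncomputable def eulerProd (x : ℂ) (n : ℕ) : ℂ := ∏ k ∈ Finset.range n, (1 - x ^ (k + 1))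

/-- The infinite product `(1 - x)(1 - x²)⋯`. -/
noncomputable def eulerProdInf (x : ℂ) : ℂ := ∏' k : ℕ, (1 + -x ^ (k + 1))

theorem gaussBinom_succ (x : ℂ) (n : ℕ) (a : ℤ) :
    gaussBinom x (n + 1) a = gaussBinom x n (a - 1) + x ^ a * gaussBinom x n a := rfl

theorem gaussBinom_of_neg (x : ℂ) (n : ℕ) {a : ℤ} (ha : a < 0) : gaussBinom x n a = 0 := by
  induction n generalizing a with
  | zero => simp [gaussBinom, ha.ne]
  | succ n ih => rw [gaussBinom_succ, ih ha, ih (by lia)]; simp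

theorem gaussBinom_of_lt (x : ℂ) (n : ℕ) {a : ℤ} (ha : (n : ℤ) < a) : gaussBinom x n a = 0 := by
  induction n generalizing a with
  | zero => simp [gaussBinom, show a ≠ 0 by lia]
  | succ n ih => rw [gaussBinom_succ, ih (by lia), ih (by lia)]; simp

theorem gaussBinom_zero_right (x : ℂ) (n : ℕ) : gaussBinom x n 0 = 1 := by
  induction n with
  | zero => simp [gaussBinom]
  | succ n ih => rw [gaussBinom_succ, ih, gaussBinom_of_neg x n (by lia)]; simp

/-- The second Pascal rule. -/
theorem gaussBinom_succ' {x : ℂ} (hx : x ≠ 0) (n : ℕ) (a : ℤ) :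
    gaussBinom x (n + 1) a =
      gaussBinom x n a + x ^ ((n : ℤ) + 1 - a) * gaussBinom x n (a - 1) := by
  induction n generalizing a with
  | zero =>
    rw [gaussBinom_succ]
    simp only [gaussBinom]
    by_cases h0 : a = 0
    · simp [h0]
    · by_cases h1 : a = 1
      · simp [h1]
      · simp [h0, show a - 1 ≠ 0 by lia]
  | succ n ih =>
    rw [gaussBinom_succ x (n + 1), ih (a - 1), ih a]
    have p1 := ih a
    have p2 := ih (a - 1)
    rw [gaussBinom_succ] at p1 p2
    have e1 : x ^ a * x ^ ((n : ℤ) + 1 - a) = x ^ ((n : ℤ) + 1) := by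
      rw [← zpow_add₀ hx]; congr 1; ring
    have e2 : x ^ (((n + 1 : ℕ) : ℤ) + 1 - a) * x ^ (a - 1) = x ^ ((n : ℤ) + 1) := by
      rw [← zpow_add₀ hx]; congr 1; push_cast; ring
    have e3 : (n : ℤ) + 1 - (a - 1) = ((n + 1 : ℕ) : ℤ) + 1 - a := by push_cast; ring
    rw [e3] at p2 ⊢
    linear_combination p1 + x ^ (((n + 1 : ℕ) : ℤ) + 1 - a) * p2 +
      gaussBinom x n (a - 1) * (e1 - e2)

/-- Equating the two Pascal rules gives `(1 - x^(a+1)) [n; a+1] = (1 - x^(n-a)) [n; a]`, which is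
the induction step in `a`. -/
theorem gaussBinom_mul_eulerProd {x : ℂ} (hx : x ≠ 0) (n a : ℕ) (ha : a ≤ n) :
    gaussBinom x n a * (eulerProd x a * eulerProd x (n - a)) = eulerProd x n := by
  induction a with
  | zero => simp [gaussBinom_zero_right, eulerProd]
  | succ a ih =>
    have h := gaussBinom_succ' hx n (a + 1)
    rw [gaussBinom_succ] at h
    have e1 : eulerProd x (a + 1) = eulerProd x a * (1 - x ^ (a + 1)) :=
      Finset.prod_range_succ _ _
    obtain ⟨m, rfl⟩ : ∃ m, n = a + 1 + m := ⟨n - (a + 1), by lia⟩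
    have e2 : eulerProd x (m + 1) = eulerProd x m * (1 - x ^ (m + 1)) :=
      Finset.prod_range_succ _ _
    have ih := ih (by lia)
    rw [show a + 1 + m - a = m + 1 by lia, e2] at ih
    rw [show a + 1 + m - (a + 1) = m by lia, e1]
    rw [show ((a + 1 + m : ℕ) : ℤ) + 1 - (a + 1) = ((m + 1 : ℕ) : ℤ) by push_cast; ring,
      show ((a : ℤ) + 1) = ((a + 1 : ℕ) : ℤ) by push_cast; ring, zpow_natCast, zpow_natCast,
      show ((a + 1 : ℕ) : ℤ) - 1 = (a : ℤ) by push_cast; ring] at h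
    rw [← ih]
    linear_combination -(eulerProd x a * eulerProd x m) * h

theorem summable_norm_pow_succ {x : ℂ} (hx : ‖x‖ < 1) : Summable fun k : ℕ => ‖-x ^ (k + 1)‖ := by
  simp only [norm_neg, norm_pow]
  exact (summable_nat_add_iff 1).2 (summable_geometric_of_lt_one (norm_nonneg _) hx)

theorem one_sub_pow_ne_zero {x : ℂ} (hx : ‖x‖ < 1) {k : ℕ} (hk : k ≠ 0) : 1 - x ^ k ≠ 0 := by
  intro h
  have : ‖x ^ k‖ = 1 := by rw [← sub_eq_zero.1 h, norm_one]
  rw [norm_pow] at this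
  exact (pow_lt_one₀ (norm_nonneg _) hx hk).ne this

theorem eulerProd_ne_zero {x : ℂ} (hx : ‖x‖ < 1) (n : ℕ) : eulerProd x n ≠ 0 :=
  Finset.prod_ne_zero_iff.2 fun _ _ => one_sub_pow_ne_zero hx (Nat.succ_ne_zero _)

theorem eulerProdInf_ne_zero {x : ℂ} (hx : ‖x‖ < 1) : eulerProdInf x ≠ 0 := by
  refine tprod_one_add_ne_zero_of_summable (fun k => ?_) (summable_norm_pow_succ hx)
  simpa [sub_eq_add_neg] using one_sub_pow_ne_zero hx (Nat.succ_ne_zero k)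

theorem tendsto_eulerProd {x : ℂ} (hx : ‖x‖ < 1) :
    Tendsto (eulerProd x) atTop (𝓝 (eulerProdInf x)) := by
  have := (multipliable_one_add_of_summable
    (summable_norm_pow_succ hx)).hasProd.tendsto_prod_nat
  simpa only [eulerProdInf, eulerProd, sub_eq_add_neg, funext_iff] using! this

theorem gaussBinom_eq {x : ℂ} (hx0 : x ≠ 0) (hx : ‖x‖ < 1) (n a : ℕ) (ha : a ≤ n) :
    gaussBinom x n a = eulerProd x n * ((eulerProd x a)⁻¹ * (eulerProd x (n - a))⁻¹) := by
  have h1 := eulerProd_ne_zero hx a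
  have h2 := eulerProd_ne_zero hx (n - a)
  rw [← gaussBinom_mul_eulerProd hx0 n a ha]
  field_simp

/-- The finite products and their inverses converge, hence are bounded. The uniform constant is what
dominated convergence needs below. -/
theorem exists_norm_gaussBinom_le {x : ℂ} (hx0 : x ≠ 0) (hx : ‖x‖ < 1) :
    ∃ C : ℝ, 0 ≤ C ∧ ∀ n a, ‖gaussBinom x n a‖ ≤ C := by
  have ht := tendsto_eulerProd hx
  obtain ⟨A, hA⟩ := (Metric.isBounded_range_of_tendsto _ ht).exists_norm_le
  obtain ⟨B, hB⟩ := (Metric.isBounded_range_of_tendsto _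
    (ht.inv₀ (eulerProdInf_ne_zero hx))).exists_norm_le
  simp only [Set.mem_range, forall_exists_index, forall_apply_eq_imp_iff] at hA hB
  have hA0 : 0 ≤ A := (norm_nonneg _).trans (hA 0)
  have hB0 : 0 ≤ B := (norm_nonneg _).trans (hB 0)
  refine ⟨A * (B * B), by positivity, fun n a => ?_⟩
  rcases lt_or_ge a 0 with h | h
  · rw [gaussBinom_of_neg x n h, norm_zero]; positivity
  · rcases lt_or_ge (n : ℤ) a with h' | h'
    · rw [gaussBinom_of_lt x n h', norm_zero]; positivity
    · lift a to ℕ using h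
      rw [gaussBinom_eq hx0 hx n a (by lia), norm_mul, norm_mul]
      gcongr
      exacts [hA n, hB a, hB (n - a)]

/-- All three Euler products in the quotient formula converge to the same nonzero limit, so one
inverse factor survives. -/
theorem tendsto_gaussBinom {x : ℂ} (hx0 : x ≠ 0) (hx : ‖x‖ < 1) {N : ℕ → ℕ} {a : ℕ → ℤ}
    (ha : Tendsto a atTop atTop) (hb : Tendsto (fun n => (N n : ℤ) - a n) atTop atTop) :
    Tendsto (fun n => gaussBinom x (N n) (a n)) atTop (𝓝 (eulerProdInf x)⁻¹) := by
  have ht := tendsto_eulerProd hx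
  have h0 := eulerProdInf_ne_zero hx
  have hN : Tendsto N atTop atTop := by
    rw [← tendsto_natCast_atTop_iff (R := ℤ)]
    simpa using ha.atTop_add_atTop hb
  have toNat : Tendsto Int.toNat atTop atTop :=
    tendsto_atTop.2 fun b => by
      filter_upwards [eventually_ge_atTop (b : ℤ)] with c hc
      lia
  have key : Tendsto (fun n => eulerProd x (N n) * ((eulerProd x (a n).toNat)⁻¹ *
      (eulerProd x ((N n : ℤ) - a n).toNat)⁻¹)) atTop (𝓝 (eulerProdInf x *
        ((eulerProdInf x)⁻¹ * (eulerProdInf x)⁻¹))) :=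
    (ht.comp hN).mul (((ht.comp (toNat.comp ha)).inv₀ h0).mul
      ((ht.comp (toNat.comp hb)).inv₀ h0))
  rw [mul_inv_cancel_left₀ h0] at key
  refine key.congr' ?_
  filter_upwards [ha.eventually_ge_atTop 0, hb.eventually_ge_atTop 0] with n h1 h2
  obtain ⟨c, hc⟩ := Int.eq_ofNat_of_zero_le h1
  rw [hc] at h2 ⊢
  rw [gaussBinom_eq hx0 hx _ _ (by lia)]
  congr 3
  congr 1
  lia

/-! ### Schur's formula for the continuants. -/

/-- A sum of Gaussian binomial coefficients with injectively varying lower index is finite. -/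
theorem summable_mul_gaussBinom (x : ℂ) (n : ℕ) (f : ℤ → ℂ) {g : ℤ → ℤ}
    (hg : Function.Injective g) : Summable fun i => f i * gaussBinom x n (g i) := by
  refine summable_of_hasFiniteSupport
    (((Set.finite_Icc (0 : ℤ) n).preimage hg.injOn).subset fun i hi => ?_)
  by_contra h
  simp only [Set.mem_preimage, Set.mem_Icc, not_and_or, not_le] at h
  rcases h with h | h
  · exact hi (by simp [gaussBinom_of_neg x n h])
  · exact hi (by simp [gaussBinom_of_lt x n h])

/-- Leaving `b` and `e'` free turns the matching of indices and exponents into separate `ring`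
goals; Schur's recurrence is then a linear combination of such instances. -/
theorem zpow_mul_gaussBinom_succ {x : ℂ} (hx : x ≠ 0) (n : ℕ) {a b e e' : ℤ} (hb : b = a - 1)
    (he : e' = e + a) :
    x ^ e * gaussBinom x (n + 1) a = x ^ e * gaussBinom x n b + x ^ e' * gaussBinom x n a := by
  rw [gaussBinom_succ, hb, he, zpow_add₀ hx]; ring

theorem zpow_mul_gaussBinom_succ' {x : ℂ} (hx : x ≠ 0) (n : ℕ) {a b e e' : ℤ} (hb : b = a - 1)
    (he : e' = e + (n + 1 - a)) :
    x ^ e * gaussBinom x (n + 1) a = x ^ e * gaussBinom x n a + x ^ e' * gaussBinom x n b := by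
  rw [gaussBinom_succ' hx, hb, he, zpow_add₀ hx e]; ring

/-- The pair of summands with index `i` in Schur's formula for the continuants of the
Rogers–Ramanujan continued fraction. -/
noncomputable def schurTerm (x : ℂ) (s : ℤ) (n : ℕ) (i : ℤ) : ℂ :=
  x ^ (10 * i ^ 2 + (1 - 4 * s) * i) * gaussBinom x n ((n : ℤ) / 2 + s - 5 * i) -
    x ^ (10 * i ^ 2 + (11 - 4 * s) * i + 3 - 2 * s) *
      gaussBinom x n (((n : ℤ) - 5) / 2 + s - 5 * i)

/-- Schur's alternating sum of Gaussian binomial coefficients; `s = 0` and `s = 1` give the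
denominators and numerators of the Rogers–Ramanujan continued fraction. -/
noncomputable def schurSum (x : ℂ) (s : ℤ) (n : ℕ) : ℂ := ∑' i : ℤ, schurTerm x s n i

theorem summable_schurTerm (x : ℂ) (s : ℤ) (n : ℕ) : Summable (schurTerm x s n) :=
  (summable_mul_gaussBinom x n _ (fun i j h => by lia)).sub
    (summable_mul_gaussBinom x n _ (fun i j h => by lia))

/-- The recurrence holds term by term: after one Pascal step both summands carry the same power of
`x`, and after the second the common binomial `[2m+1; m-1+s-5i]` cancels. -/
theorem schurTerm_odd {x : ℂ} (hx : x ≠ 0) (s : ℤ) (m : ℕ) (i : ℤ) :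
    schurTerm x s (2 * m + 3) i =
      schurTerm x s (2 * m + 2) i + x ^ (2 * m + 2) * schurTerm x s (2 * m + 1) i := by
  simp only [schurTerm]
  rw [show ((2 * m + 3 : ℕ) : ℤ) / 2 + s - 5 * i = m + 1 + s - 5 * i by lia,
    show (((2 * m + 3 : ℕ) : ℤ) - 5) / 2 + s - 5 * i = m - 1 + s - 5 * i by lia,
    show ((2 * m + 2 : ℕ) : ℤ) / 2 + s - 5 * i = m + 1 + s - 5 * i by lia,
    show (((2 * m + 2 : ℕ) : ℤ) - 5) / 2 + s - 5 * i = m - 2 + s - 5 * i by lia,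
    show ((2 * m + 1 : ℕ) : ℤ) / 2 + s - 5 * i = m + s - 5 * i by lia,
    show (((2 * m + 1 : ℕ) : ℤ) - 5) / 2 + s - 5 * i = m - 2 + s - 5 * i by lia]
  set e₁ := 10 * i ^ 2 + (1 - 4 * s) * i with he₁
  set e₂ := 10 * i ^ 2 + (11 - 4 * s) * i + 3 - 2 * s with he₂
  have T1 := zpow_mul_gaussBinom_succ' hx (2 * m + 2) (a := m + 1 + s - 5 * i)
    (b := m + s - 5 * i) (e := e₁) (e' := e₁ + m + 2 - s + 5 * i)
    (by ring) (by push_cast; ring)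
  have T2 := zpow_mul_gaussBinom_succ hx (2 * m + 2) (a := m - 1 + s - 5 * i)
    (b := m - 2 + s - 5 * i) (e := e₂) (e' := e₁ + m + 2 - s + 5 * i)
    (by ring) (by rw [he₁, he₂]; ring)
  have T3 := zpow_mul_gaussBinom_succ hx (2 * m + 1) (a := m + s - 5 * i)
    (b := m - 1 + s - 5 * i) (e := e₁ + m + 2 - s + 5 * i) (e' := e₁ + (2 * m + 2 : ℕ))
    (by ring) (by push_cast; ring)
  have T4 := zpow_mul_gaussBinom_succ' hx (2 * m + 1) (a := m - 1 + s - 5 * i)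
    (b := m - 2 + s - 5 * i) (e := e₁ + m + 2 - s + 5 * i) (e' := e₂ + (2 * m + 2 : ℕ))
    (by ring) (by rw [he₁, he₂]; push_cast; ring)
  rw [zpow_add₀ hx _ ((2 * m + 2 : ℕ) : ℤ), zpow_natCast] at T3 T4
  linear_combination T1 - T2 + T3 - T4

/-- Here the two leftover powers differ, but the second leftover is the first with `i` replaced by
`i + 1`; the defect telescopes in the sum over `i`. -/
theorem schurTerm_even {x : ℂ} (hx : x ≠ 0) (s : ℤ) (m : ℕ) (i : ℤ) :
    schurTerm x s (2 * m + 2) i =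
      schurTerm x s (2 * m + 1) i + x ^ (2 * m + 1) * schurTerm x s (2 * m) i +
      (x ^ (10 * i ^ 2 - (4 + 4 * s) * i + m + 1 + s) *
          gaussBinom x (2 * m) (m + 1 + s - 5 * i) -
        x ^ (10 * (i + 1) ^ 2 - (4 + 4 * s) * (i + 1) + m + 1 + s) *
          gaussBinom x (2 * m) (m + 1 + s - 5 * (i + 1))) := by
  simp only [schurTerm]
  rw [show ((2 * m + 2 : ℕ) : ℤ) / 2 + s - 5 * i = m + 1 + s - 5 * i by lia,
    show (((2 * m + 2 : ℕ) : ℤ) - 5) / 2 + s - 5 * i = m - 2 + s - 5 * i by lia,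
    show ((2 * m + 1 : ℕ) : ℤ) / 2 + s - 5 * i = m + s - 5 * i by lia,
    show (((2 * m + 1 : ℕ) : ℤ) - 5) / 2 + s - 5 * i = m - 2 + s - 5 * i by lia,
    show ((2 * m : ℕ) : ℤ) / 2 + s - 5 * i = m + s - 5 * i by lia,
    show (((2 * m : ℕ) : ℤ) - 5) / 2 + s - 5 * i = m - 3 + s - 5 * i by lia,
    show m + 1 + s - 5 * (i + 1) = m - 4 + s - 5 * i by ring]
  set e₁ := 10 * i ^ 2 + (1 - 4 * s) * i with he₁
  set e₂ := 10 * i ^ 2 + (11 - 4 * s) * i + 3 - 2 * s with he₂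
  set u := 10 * i ^ 2 - (4 + 4 * s) * i + m + 1 + s with hu
  set w := 10 * (i + 1) ^ 2 - (4 + 4 * s) * (i + 1) + m + 1 + s with hw
  have T1 := zpow_mul_gaussBinom_succ hx (2 * m + 1) (a := m + 1 + s - 5 * i)
    (b := m + s - 5 * i) (e := e₁) (e' := u) (by ring) (by rw [he₁, hu]; ring)
  have T2 := zpow_mul_gaussBinom_succ' hx (2 * m + 1) (a := m - 2 + s - 5 * i)
    (b := m - 3 + s - 5 * i) (e := e₂) (e' := w)
    (by ring) (by rw [he₂, hw]; push_cast; ring)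
  have T3 := zpow_mul_gaussBinom_succ' hx (2 * m) (a := m + 1 + s - 5 * i)
    (b := m + s - 5 * i) (e := u) (e' := e₁ + (2 * m + 1 : ℕ))
    (by ring) (by rw [he₁, hu]; push_cast; ring)
  have T4 := zpow_mul_gaussBinom_succ hx (2 * m) (a := m - 3 + s - 5 * i)
    (b := m - 4 + s - 5 * i) (e := w) (e' := e₂ + (2 * m + 1 : ℕ))
    (by ring) (by rw [he₂, hw]; push_cast; ring)
  rw [zpow_add₀ hx _ ((2 * m + 1 : ℕ) : ℤ), zpow_natCast] at T3 T4
  linear_combination T1 - T2 + T3 - T4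

theorem hasSum_int_sub_succ {f : ℤ → ℂ} (hf : Summable f) :
    HasSum (fun i => f i - f (i + 1)) 0 := by
  have h : HasSum (fun i => f (i + 1)) (∑' i, f i) :=
    (Equiv.addRight (1 : ℤ)).hasSum_iff.2 hf.hasSum
  simpa using hf.hasSum.sub h

theorem schurSum_add_two {x : ℂ} (hx : x ≠ 0) (s : ℤ) (n : ℕ) :
    schurSum x s (n + 2) = schurSum x s (n + 1) + x ^ (n + 1) * schurSum x s n := by
  have hs := fun k => (summable_schurTerm x s k).hasSum
  have h1 := (hs (n + 1)).add ((hs n).mul_left (x ^ (n + 1)))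
  obtain ⟨m, rfl | rfl⟩ := n.even_or_odd'
  · have hf : Summable fun i : ℤ => x ^ (10 * i ^ 2 - (4 + 4 * s) * i + m + 1 + s) *
        gaussBinom x (2 * m) (m + 1 + s - 5 * i) :=
      summable_mul_gaussBinom x _ _ (fun i j h => by lia)
    have h2 := h1.add (hasSum_int_sub_succ hf)
    rw [add_zero] at h2
    exact (hs _).unique (h2.congr_fun fun i => schurTerm_even hx s m i)
  · exact (hs _).unique (h1.congr_fun fun i => schurTerm_odd hx s m i)

/-- Supplies the initial values of the recurrence: for `n ≤ 1` every other lower index falls outside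
`[0, n]`. -/
theorem schurSum_eq_single (x : ℂ) {s : ℤ} {n : ℕ} (hs : s = 0 ∨ s = 1) (hn : n ≤ 1) :
    schurSum x s n = gaussBinom x n s := by
  have key : ∀ i : ℤ, (i ≠ 0 → gaussBinom x n ((n : ℤ) / 2 + s - 5 * i) = 0) ∧
      gaussBinom x n (((n : ℤ) - 5) / 2 + s - 5 * i) = 0 := fun i => by
    constructor
    · intro hi
      rcases lt_or_gt_of_ne hi with h | h
      · exact gaussBinom_of_lt x n (by lia)
      · exact gaussBinom_of_neg x n (by lia)
    · rcases lt_or_ge i 0 with h | h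
      · exact gaussBinom_of_lt x n (by lia)
      · exact gaussBinom_of_neg x n (by lia)
  rw [schurSum, tsum_eq_single 0 fun i hi => by simp [schurTerm, (key i).1 hi, (key i).2]]
  simp only [schurTerm, (key 0).2]
  simp [show (n : ℤ) / 2 = 0 by lia]

theorem tsum_int_even_add_odd {f : ℤ → ℂ} (hf : Summable f) :
    ∑' j, f j = ∑' i, (f (2 * i) + f (2 * i + 1)) := by
  have h2 := mul_right_injective₀ (two_ne_zero' ℤ)
  have h3 := (add_left_injective (1 : ℤ)).comp h2
  have he : Summable fun i => f (2 * i) := hf.comp_injective h2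
  have ho : Summable fun i => f (2 * i + 1) := hf.comp_injective h3
  rw [he.tsum_add ho]
  refine HasSum.tsum_eq ((h2.hasSum_range_iff.2 he.hasSum).add_isCompl ?_
    (h3.hasSum_range_iff.2 ho.hasSum))
  simpa [Function.comp_def] using Int.isCompl_even_odd

/-- `f j` plays the role of `(-1)^j x^((5j² + (1-4s)j)/2)`, prescribed separately on even and odd
`j` to avoid the halved exponent. Its summability gives the dominating series. -/
theorem tendsto_schurSum {x : ℂ} (hx0 : x ≠ 0) (hx : ‖x‖ < 1) (s : ℤ) {f : ℤ → ℂ}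
    (hf : Summable f) (he : ∀ i, f (2 * i) = x ^ (10 * i ^ 2 + (1 - 4 * s) * i))
    (ho : ∀ i, f (2 * i + 1) = -x ^ (10 * i ^ 2 + (11 - 4 * s) * i + 3 - 2 * s)) :
    Tendsto (schurSum x s) atTop (𝓝 ((∑' j, f j) * (eulerProdInf x)⁻¹)) := by
  obtain ⟨C, hC0, hC⟩ := exists_norm_gaussBinom_le hx0 hx
  rw [tsum_int_even_add_odd hf, ← tsum_mul_right]
  have h2 := mul_right_injective₀ (two_ne_zero' ℤ)
  have h3 := (add_left_injective (1 : ℤ)).comp h2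
  have hes : Summable fun i => ‖f (2 * i)‖ := hf.norm.comp_injective h2
  have hos : Summable fun i => ‖f (2 * i + 1)‖ := hf.norm.comp_injective h3
  have hdiv : ∀ c : ℤ, Tendsto (fun n : ℕ => (n : ℤ) / 2 + c) atTop atTop := fun c =>
    tendsto_atTop.2 fun b => by
      filter_upwards [eventually_ge_atTop (2 * (b - c)).toNat] with n hn
      lia
  refine tendsto_tsum_of_dominated_convergence
    (bound := fun i => (‖f (2 * i)‖ + ‖f (2 * i + 1)‖) * C) ((hes.add hos).mul_right C)
    (fun i => ?_) (Eventually.of_forall fun n i => ?_)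
  · simp only [he, ho, ← sub_eq_add_neg, sub_mul, schurTerm]
    refine (Tendsto.const_mul _ (tendsto_gaussBinom hx0 hx ?_ ?_)).sub
      (Tendsto.const_mul _ (tendsto_gaussBinom hx0 hx ?_ ?_))
    · exact tendsto_atTop_mono (fun n => by lia) (hdiv (s - 5 * i))
    · exact tendsto_atTop_mono (fun n => by lia) (hdiv (5 * i - s))
    · exact tendsto_atTop_mono (fun n => by lia) (hdiv (s - 5 * i - 3))
    · exact tendsto_atTop_mono (fun n => by lia) (hdiv (5 * i - s))
  · rw [schurTerm, ← he, ← neg_neg (x ^ (_ - _)), ← ho, add_mul]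
    refine (norm_sub_le _ _).trans (add_le_add ?_ ?_)
    · rw [norm_mul]; gcongr; exact hC _ _
    · rw [norm_mul, norm_neg]; gcongr; exact hC _ _

/-! ### The theta series and the Jacobi triple product. -/

theorem nome_ne_zero (τ : ℂ) : nome τ ≠ 0 := Complex.exp_ne_zero _

theorem norm_nome_lt_one {τ : ℂ} (hτ : 0 < τ.im) : ‖nome τ‖ < 1 := by
  rw [nome, Complex.norm_exp, Real.exp_lt_one_iff]
  simpa using mul_pos Real.pi_pos hτ

theorem nome_nat_mul (n : ℕ) (τ : ℂ) : nome (n * τ) = nome τ ^ n := by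
  rw [nome, nome, ← Complex.exp_nat_mul]; ring_nf

/-- The summand of the theta function `θ₄`. -/
noncomputable def theta4Term (v τ : ℂ) (n : ℤ) : ℂ :=
  (-1 : ℂ) ^ n * nome τ ^ (n ^ 2) * Complex.exp (2 * Real.pi * Complex.I * n * v)

theorem summable_theta4Term (v : ℂ) {τ : ℂ} (hτ : 0 < τ.im) : Summable (theta4Term v τ) := by
  -- The shift of `v` by `1/2` produces the sign `(-1)^n`.
  refine ((summable_jacobiTheta₂_term_iff (v + 1 / 2) τ).2 hτ).congr fun n => ?_
  rw [jacobiTheta₂_term, theta4Term, ← Complex.exp_pi_mul_I, ← Complex.exp_int_mul, nome,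
    ← Complex.exp_int_mul, ← Complex.exp_add, ← Complex.exp_add]
  congr 1
  push_cast
  ring

theorem theta4_neg (v τ : ℂ) : theta4 (-v) τ = theta4 v τ := by
  rw [theta4, theta4, ← (Equiv.neg ℤ).tsum_eq]
  refine tsum_congr fun n => ?_
  simp [zpow_neg, ← inv_zpow]

/-- One use of the first Pascal rule, then the second on both resulting terms, raises the top by two
and keeps the lower index central. -/
theorem gaussBinom_central_succ {x : ℂ} (hx : x ≠ 0) (n : ℕ) (j : ℤ) :
    gaussBinom x (2 * (n + 1)) ((n + 1 : ℕ) + j) =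
      (1 + x ^ (2 * n + 1)) * gaussBinom x (2 * n) (n + j) +
      x ^ ((n : ℤ) + 1 - j) * gaussBinom x (2 * n) (n + (j - 1)) +
      x ^ ((n : ℤ) + 1 + j) * gaussBinom x (2 * n) (n + (j + 1)) := by
  rw [show 2 * (n + 1) = 2 * n + 1 + 1 by ring, gaussBinom_succ,
    show ((n + 1 : ℕ) : ℤ) + j - 1 = n + j by push_cast; ring,
    show ((n + 1 : ℕ) : ℤ) + j = n + (j + 1) by push_cast; ring,
    gaussBinom_succ' hx _ ((n : ℤ) + j), gaussBinom_succ' hx _ ((n : ℤ) + (j + 1)),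
    show (n : ℤ) + j - 1 = n + (j - 1) by ring, show (n : ℤ) + (j + 1) - 1 = n + j by ring,
    show ((2 * n : ℕ) : ℤ) + 1 - (n + j) = n + 1 - j by push_cast; ring,
    show (n : ℤ) + (j + 1) = n + 1 + j by ring]
  have e : x ^ ((n : ℤ) + 1 + j) * x ^ (((2 * n : ℕ) : ℤ) + 1 - (n + 1 + j)) =
      x ^ (2 * n + 1) := by
    rw [← zpow_add₀ hx, ← zpow_natCast]; congr 1; push_cast; ring
  linear_combination gaussBinom x (2 * n) (n + j) * e

/-- Completing the square, `j² + 2(n + 1 ∓ j) = (2n + 1) + (j ∓ 1)²`, turns the neighbouring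
binomials into shifted copies of the summand. -/
theorem summand_jacobi_succ {Q z : ℂ} (hQ : Q ≠ 0) (hz : z ≠ 0) (n : ℕ) (j : ℤ) :
    ((-1) ^ j * Q ^ (j ^ 2) * z ^ j) * gaussBinom (Q ^ 2) (2 * (n + 1)) ((n + 1 : ℕ) + j) =
      (1 + Q ^ (4 * n + 2)) *
        (((-1) ^ j * Q ^ (j ^ 2) * z ^ j) * gaussBinom (Q ^ 2) (2 * n) (n + j)) -
      Q ^ (2 * n + 1) * z * (((-1) ^ (j - 1) * Q ^ ((j - 1) ^ 2) * z ^ (j - 1)) *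
        gaussBinom (Q ^ 2) (2 * n) (n + (j - 1))) -
      Q ^ (2 * n + 1) * z⁻¹ * (((-1) ^ (j + 1) * Q ^ ((j + 1) ^ 2) * z ^ (j + 1)) *
        gaussBinom (Q ^ 2) (2 * n) (n + (j + 1))) := by
  rw [gaussBinom_central_succ (pow_ne_zero 2 hQ)]
  have hm : (-1 : ℂ) ≠ 0 := by norm_num
  have e1 : Q ^ (j ^ 2) * (Q ^ 2) ^ ((n : ℤ) + 1 - j) = Q ^ (2 * n + 1) * Q ^ ((j - 1) ^ 2) := by
    rw [← zpow_natCast Q 2, ← zpow_mul, ← zpow_add₀ hQ, ← zpow_natCast Q (2 * n + 1),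
      ← zpow_add₀ hQ]
    congr 1; push_cast; ring
  have e2 : Q ^ (j ^ 2) * (Q ^ 2) ^ ((n : ℤ) + 1 + j) = Q ^ (2 * n + 1) * Q ^ ((j + 1) ^ 2) := by
    rw [← zpow_natCast Q 2, ← zpow_mul, ← zpow_add₀ hQ, ← zpow_natCast Q (2 * n + 1),
      ← zpow_add₀ hQ]
    congr 1; push_cast; ring
  have e3 : (Q ^ 2) ^ (2 * n + 1) = Q ^ (4 * n + 2) := by rw [← pow_mul]; ring_nf
  rw [e3, zpow_sub_one₀ hm, zpow_sub_one₀ hz, zpow_add_one₀ hm, zpow_add_one₀ hz]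
  field_simp
  linear_combination gaussBinom (Q ^ 2) (2 * n) (n + (j - 1)) * e1 +
    gaussBinom (Q ^ 2) (2 * n) (n + (j + 1)) * e2

/-- A finite form of the Jacobi triple product identity. -/
theorem hasSum_jacobi_finite {Q z : ℂ} (hQ : Q ≠ 0) (hz : z ≠ 0) (n : ℕ) :
    HasSum (fun j : ℤ => ((-1) ^ j * Q ^ (j ^ 2) * z ^ j) * gaussBinom (Q ^ 2) (2 * n) (n + j))
      (∏ k ∈ Finset.range n, (1 + Q ^ (4 * k + 2) - Q ^ (2 * k + 1) * (z + z⁻¹))) := by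
  induction n with
  | zero =>
    have := hasSum_single (f := fun j : ℤ => ((-1) ^ j * Q ^ (j ^ 2) * z ^ j) *
      gaussBinom (Q ^ 2) (2 * 0) ((0 : ℕ) + j)) 0 (fun j hj => by simp [gaussBinom, hj])
    simpa [gaussBinom] using this
  | succ n ih =>
    have h1 := (Equiv.subRight (1 : ℤ)).hasSum_iff.2 ih
    have h2 := (Equiv.addRight (1 : ℤ)).hasSum_iff.2 ih
    have h := ((ih.mul_left (1 + Q ^ (4 * n + 2))).sub (h1.mul_left (Q ^ (2 * n + 1) * z))).sub
      (h2.mul_left (Q ^ (2 * n + 1) * z⁻¹))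
    rw [← sub_mul, ← sub_mul, sub_sub, ← mul_add, mul_comm (1 + Q ^ (4 * n + 2) - _)] at h
    rw [Finset.prod_range_succ]
    exact h.congr_fun fun j => summand_jacobi_succ hQ hz n j

/-- The Jacobi triple product identity for `θ₄`. -/
theorem tendsto_prod_theta4 (v : ℂ) {τ : ℂ} (hτ : 0 < τ.im) :
    Tendsto (fun n => ∏ k ∈ Finset.range n, (1 + nome τ ^ (4 * k + 2) - nome τ ^ (2 * k + 1) *
        (Complex.exp (2 * Real.pi * Complex.I * v) +
          (Complex.exp (2 * Real.pi * Complex.I * v))⁻¹))) atTop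
      (𝓝 (theta4 v τ * (eulerProdInf (nome τ ^ 2))⁻¹)) := by
  have hQ := nome_ne_zero τ
  have hx0 : nome τ ^ 2 ≠ 0 := pow_ne_zero 2 hQ
  have hx : ‖nome τ ^ 2‖ < 1 := by
    rw [norm_pow]; exact pow_lt_one₀ (norm_nonneg _) (norm_nome_lt_one hτ) two_ne_zero
  have hf := summable_theta4Term v hτ
  have hterm : ∀ j : ℤ, theta4Term v τ j = (-1) ^ j * nome τ ^ (j ^ 2) *
      Complex.exp (2 * Real.pi * Complex.I * v) ^ j := fun j => by
    rw [theta4Term, ← Complex.exp_int_mul]; ring_nf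
  obtain ⟨C, hC0, hC⟩ := exists_norm_gaussBinom_le hx0 hx
  have key : Tendsto (fun n : ℕ => ∑' j : ℤ, theta4Term v τ j *
      gaussBinom (nome τ ^ 2) (2 * n) (n + j)) atTop
      (𝓝 (∑' j : ℤ, theta4Term v τ j * (eulerProdInf (nome τ ^ 2))⁻¹)) := by
    refine tendsto_tsum_of_dominated_convergence (hf.norm.mul_right C) (fun j => ?_)
      (Eventually.of_forall fun n j => ?_)
    · have hc : ∀ c : ℤ, Tendsto (fun n : ℕ => (n : ℤ) + c) atTop atTop := fun c =>
        tendsto_atTop_add_const_right _ _ tendsto_natCast_atTop_atTop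
      refine (tendsto_gaussBinom hx0 hx (hc j) ((hc (-j)).congr fun n => ?_)).const_mul _
      push_cast; ring
    · rw [norm_mul]; gcongr; exact hC _ _
  rw [tsum_mul_right] at key
  refine key.congr fun n => ?_
  simp only [hterm]
  exact (hasSum_jacobi_finite hQ (Complex.exp_ne_zero _) n).tsum_eq

theorem theta4_half_ne_zero {τ : ℂ} (hτ : 0 < τ.im) : theta4 (τ / 2) (5 * τ) ≠ 0 := by
  have hq0 := nome_ne_zero τ
  have hq := norm_nome_lt_one hτ
  have hτ5 : 0 < (5 * τ).im := by simpa using hτ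
  have h5 : nome (5 * τ) = nome τ ^ 5 := by exact_mod_cast nome_nat_mul 5 τ
  have hz : Complex.exp (2 * Real.pi * Complex.I * (τ / 2)) = nome τ := by
    rw [nome]; ring_nf
  have h := tendsto_prod_theta4 (τ / 2) hτ5
  rw [hz, h5] at h
  set q := nome τ
  -- At `z = q` and nome `q⁵` the factor splits as `(1 - q^(10k+5) z)(1 - q^(10k+5) / z)`.
  have hfac : ∀ k : ℕ, 1 + (q ^ 5) ^ (4 * k + 2) - (q ^ 5) ^ (2 * k + 1) * (q + q⁻¹) =
      (1 - q ^ (10 * k + 6)) * (1 - q ^ (10 * k + 4)) := fun k => by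
    field_simp; ring
  have hs : ∀ c : ℕ, Summable fun k : ℕ => ‖-q ^ (10 * k + c)‖ := fun c => by
    refine ((summable_geometric_of_lt_one (by positivity) (pow_lt_one₀ (n := 10)
      (norm_nonneg q) hq (by norm_num))).mul_right (‖q‖ ^ c)).congr fun k => ?_
    rw [norm_neg, norm_pow, pow_add, pow_mul]
  have hne : ∀ c : ℕ, c ≠ 0 → ∏' k : ℕ, (1 + -q ^ (10 * k + c)) ≠ 0 := fun c hc =>
    tprod_one_add_ne_zero_of_summable (fun k => by
      simpa [sub_eq_add_neg] using one_sub_pow_ne_zero hq (show 10 * k + c ≠ 0 by lia)) (hs c)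
  have hp : ∀ c : ℕ, Tendsto (fun n => ∏ k ∈ Finset.range n, (1 + -q ^ (10 * k + c))) atTop
      (𝓝 (∏' k : ℕ, (1 + -q ^ (10 * k + c)))) := fun c =>
    (multipliable_one_add_of_summable (hs c)).hasProd.tendsto_prod_nat
  have h' := (hp 6).mul (hp 4)
  simp only [hfac] at h
  simp only [← Finset.prod_mul_distrib, ← sub_eq_add_neg] at h'
  have := tendsto_nhds_unique h h'
  intro h0
  rw [h0, zero_mul] at this
  simp only [sub_eq_add_neg] at this
  exact mul_ne_zero (hne 6 (by norm_num)) (hne 4 (by norm_num)) this.symm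

/-! ### The continued fraction as a theta quotient. -/

theorem tendsto_schurSum_nome {τ : ℂ} (hτ : 0 < τ.im) (s : ℤ) :
    Tendsto (schurSum (nome τ ^ 2) s) atTop
      (𝓝 (theta4 ((1 - 4 * s) * (τ / 2)) (5 * τ) * (eulerProdInf (nome τ ^ 2))⁻¹)) := by
  have hq0 := nome_ne_zero τ
  have hx : ‖nome τ ^ 2‖ < 1 := by
    rw [norm_pow]; exact pow_lt_one₀ (norm_nonneg _) (norm_nome_lt_one hτ) two_ne_zero
  have hτ5 : 0 < (5 * τ).im := by simpa using hτ
  have hterm : ∀ j : ℤ, theta4Term ((1 - 4 * s) * (τ / 2)) (5 * τ) j =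
      (-1) ^ j * nome τ ^ (5 * j ^ 2 + (1 - 4 * s) * j) := fun j => by
    rw [theta4Term, nome, nome, ← Complex.exp_int_mul, ← Complex.exp_int_mul, mul_assoc,
      ← Complex.exp_add]
    congr 2
    push_cast
    ring
  refine tendsto_schurSum (f := theta4Term ((1 - 4 * s) * (τ / 2)) (5 * τ))
    (pow_ne_zero 2 hq0) hx s (summable_theta4Term _ hτ5) (fun i => ?_) fun i => ?_
  · rw [hterm, (even_two_mul i).neg_one_zpow, one_mul, ← zpow_natCast _ 2, ← zpow_mul]
    congr 1; push_cast; ring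
  · rw [hterm, (odd_two_mul_add_one i).neg_one_zpow, ← zpow_natCast _ 2, ← zpow_mul,
      neg_one_mul]
    congr 2; push_cast; ring

theorem contFract_s_get? (τ : ℂ) (n : ℕ) : (contFract τ).s.get? n =
    some ⟨if n = 0 then nomeTwoFifths τ else nome τ ^ (2 * n), 1⟩ := rfl

theorem contFract_dens (τ : ℂ) (n : ℕ) :
    (contFract τ).dens n = schurSum (nome τ ^ 2) 0 n := by
  induction n using Nat.twoStepInduction with
  | zero => simp [schurSum_eq_single, gaussBinom]
  | one =>
    rw [GenContFract.first_den_eq (contFract_s_get? τ 0)]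
    simp [schurSum_eq_single, gaussBinom]
  | more n h0 h1 =>
    rw [GenContFract.dens_recurrence (contFract_s_get? τ (n + 1)) h0 h1,
      schurSum_add_two (pow_ne_zero 2 (nome_ne_zero τ))]
    simp [pow_mul]

theorem contFract_nums (τ : ℂ) (n : ℕ) :
    (contFract τ).nums n = nomeTwoFifths τ * schurSum (nome τ ^ 2) 1 n := by
  induction n using Nat.twoStepInduction with
  | zero => simp [schurSum_eq_single, gaussBinom, contFract]
  | one =>
    rw [GenContFract.first_num_eq (contFract_s_get? τ 0)]
    simp [schurSum_eq_single, gaussBinom, contFract]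
  | more n h0 h1 =>
    rw [GenContFract.nums_recurrence (contFract_s_get? τ (n + 1)) h0 h1,
      schurSum_add_two (pow_ne_zero 2 (nome_ne_zero τ))]
    simp only [Nat.succ_ne_zero, if_false, pow_mul]
    ring

theorem tendsto_convs {τ : ℂ} (hτ : 0 < τ.im) :
    Tendsto (contFract τ).convs atTop (𝓝 (nomeTwoFifths τ *
      (theta4 (3 * τ / 2) (5 * τ) / theta4 (τ / 2) (5 * τ)))) := by
  have hx : ‖nome τ ^ 2‖ < 1 := by
    rw [norm_pow]; exact pow_lt_one₀ (norm_nonneg _) (norm_nome_lt_one hτ) two_ne_zero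
  have hP := inv_ne_zero (eulerProdInf_ne_zero hx)
  have h0 := tendsto_schurSum_nome hτ 0
  have h1 := tendsto_schurSum_nome hτ 1
  rw [show (1 - 4 * ((0 : ℤ) : ℂ)) * (τ / 2) = τ / 2 by push_cast; ring] at h0
  rw [show (1 - 4 * ((1 : ℤ) : ℂ)) * (τ / 2) = -(3 * τ / 2) by push_cast; ring, theta4_neg] at h1
  -- Only the limit of the denominators has to be nonzero; individual denominators may vanish.
  have h := (h1.div h0 (mul_ne_zero (theta4_half_ne_zero hτ) hP)).const_mul (nomeTwoFifths τ)
  rw [mul_div_mul_right _ _ hP] at h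
  refine h.congr fun n => ?_
  rw [GenContFract.conv_eq_num_div_den, contFract_nums, contFract_dens, mul_div_assoc]
  rfl

theorem R_eq {τ : ℂ} (hτ : 0 < τ.im) : R τ = nomeTwoFifths τ *
    (theta4 (3 * τ / 2) (5 * τ) / theta4 (τ / 2) (5 * τ)) := (tendsto_convs hτ).limUnder_eq

/-! ### The logarithm of `θ₄` in powers of the sine. -/

theorem four_mul_sin_pi_sq (v : ℂ) :
    4 * Complex.sin (Real.pi * v) ^ 2 = 2 - (Complex.exp (2 * Real.pi * Complex.I * v) +
      (Complex.exp (2 * Real.pi * Complex.I * v))⁻¹) := by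
  have h : Complex.exp (2 * Real.pi * Complex.I * v) =
      Complex.exp (Real.pi * v * Complex.I) ^ 2 := by
    rw [← Complex.exp_nat_mul]; push_cast; ring_nf
  have h0 := Complex.exp_ne_zero (Real.pi * v * Complex.I)
  rw [h, Complex.sin, neg_mul, Complex.exp_neg]
  field_simp
  rw [Complex.I_sq]
  ring

theorem sin_half_sq_mul (t : ℂ) (k : ℕ) :
    Complex.sin (((k : ℂ) + 1 / 2) * Real.pi * t) ^ 2 * (4 * nome t ^ (2 * k + 1)) =
      -(1 - nome t ^ (2 * k + 1)) ^ 2 := by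
  have h := four_mul_sin_pi_sq (((k : ℂ) + 1 / 2) * t)
  have hz : Complex.exp (2 * Real.pi * Complex.I * (((k : ℂ) + 1 / 2) * t)) =
      nome t ^ (2 * k + 1) := by
    rw [nome, ← Complex.exp_nat_mul]; push_cast; ring_nf
  rw [hz, show Real.pi * (((k : ℂ) + 1 / 2) * t) = ((k : ℂ) + 1 / 2) * Real.pi * t by ring] at h
  have h0 := pow_ne_zero (2 * k + 1) (nome_ne_zero t)
  rw [show ∀ a b : ℂ, a * (4 * b) = 4 * a * b by intros; ring, h]
  field_simp
  ring

theorem one_sub_nome_pow_ne_zero {t : ℂ} (ht : 0 < t.im) (k : ℕ) :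
    1 - nome t ^ (2 * k + 1) ≠ 0 :=
  one_sub_pow_ne_zero (norm_nome_lt_one ht) (by lia)

theorem inv_sin_half_sq {t : ℂ} (ht : 0 < t.im) (k : ℕ) :
    1 / Complex.sin (((k : ℂ) + 1 / 2) * Real.pi * t) ^ 2 =
      -(4 * nome t ^ (2 * k + 1)) / (1 - nome t ^ (2 * k + 1)) ^ 2 := by
  have h := sin_half_sq_mul t k
  have h1 := pow_ne_zero 2 (one_sub_nome_pow_ne_zero ht k)
  have hs : Complex.sin (((k : ℂ) + 1 / 2) * Real.pi * t) ^ 2 ≠ 0 := fun h0 => by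
    rw [h0, zero_mul] at h
    exact h1 (neg_eq_zero.1 h.symm)
  rw [div_eq_div_iff hs h1]
  linear_combination h

/-- With `Q` the nome, the terms are `-4Q^(2k+1) / (1 - Q^(2k+1))²`; the denominators stay at least
`(1 - |Q|)²` in modulus and the numerators are geometric. -/
theorem summable_norm_inv_sin_half_sq {t : ℂ} (ht : 0 < t.im) :
    Summable fun k : ℕ => ‖1 / Complex.sin (((k : ℂ) + 1 / 2) * Real.pi * t) ^ 2‖ := by
  have hQ := norm_nome_lt_one ht
  have hg : Summable fun k : ℕ => ‖nome t‖ ^ (2 * k + 1) :=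
    (summable_geometric_of_lt_one (norm_nonneg _) hQ).comp_injective
      (i := fun k : ℕ => 2 * k + 1) fun a b h => by lia
  refine Summable.of_nonneg_of_le (fun _ => norm_nonneg _) (fun k => ?_)
    (hg.mul_left (4 / (1 - ‖nome t‖) ^ 2))
  rw [inv_sin_half_sq ht, norm_div, norm_neg, norm_mul, norm_pow, norm_pow, div_mul_eq_mul_div]
  have h1 : 1 - ‖nome t‖ ≤ ‖1 - nome t ^ (2 * k + 1)‖ := by
    have := norm_sub_norm_le (1 : ℂ) (nome t ^ (2 * k + 1))
    rw [norm_one, norm_pow] at this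
    have := pow_le_of_le_one (norm_nonneg _) hQ.le (show 2 * k + 1 ≠ 0 by lia)
    linarith
  have h2 : 0 < 1 - ‖nome t‖ := by linarith
  rw [show ‖(4 : ℂ)‖ = 4 by norm_num]
  gcongr

theorem Summable.pow_of_norm {f : ℕ → ℂ} (hf : Summable fun k => ‖f k‖) {p : ℕ} (hp : 1 ≤ p) :
    Summable fun k => f k ^ p := by
  refine Summable.of_norm_bounded_eventually_nat hf ?_
  filter_upwards [hf.tendsto_atTop_zero.eventually_le_const zero_lt_one] with k hk
  rw [norm_pow]
  exact pow_le_of_le_one (norm_nonneg _) hk (by lia)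

theorem summable_inv_sin_half_pow {t : ℂ} (ht : 0 < t.im) {p : ℕ} (hp : 1 ≤ p) :
    Summable fun k : ℕ => 1 / Complex.sin (((k : ℂ) + 1 / 2) * Real.pi * t) ^ (2 * p) := by
  refine (Summable.pow_of_norm (summable_norm_inv_sin_half_sq ht) hp).congr fun k => ?_
  rw [one_div_pow, ← pow_mul]

theorem summable_pow_succ_div {r : ℕ → ℂ} (hr : Summable fun k => ‖r k‖)
    (h1 : ∀ k, ‖r k‖ < 1) :
    Summable fun x : ℕ × ℕ => 1 / ((x.1 + 1 : ℕ) : ℂ) * r x.2 ^ (x.1 + 1) := by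
  have hs : Summable fun x : ℕ × ℕ => ‖r x.1‖ ^ (x.2 + 1) := by
    rw [summable_prod_of_nonneg fun _ => by positivity]
    refine ⟨fun k => (summable_nat_add_iff 1).2
      (summable_geometric_of_lt_one (norm_nonneg _) (h1 k)), ?_⟩
    have hk : ∀ k, ∑' p : ℕ, ‖r k‖ ^ (p + 1) = ‖r k‖ * (1 - ‖r k‖)⁻¹ := fun k => by
      simp only [pow_succ']
      rw [tsum_mul_left, tsum_geometric_of_lt_one (norm_nonneg _) (h1 k)]
    simp only [hk]
    -- Once `‖r k‖ ≤ 1/2`, the factor `(1 - ‖r k‖)⁻¹` is at most `2`.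
    refine Summable.of_norm_bounded_eventually_nat (hr.mul_right 2) ?_
    filter_upwards [hr.tendsto_atTop_zero.eventually_le_const (show (0 : ℝ) < 1 / 2 by norm_num)]
      with k hk
    rw [norm_mul, norm_norm, norm_inv, Real.norm_of_nonneg (by linarith)]
    gcongr
    rw [inv_le_comm₀ (by linarith) two_pos]
    linarith
  refine Summable.of_norm_bounded ((Equiv.prodComm ℕ ℕ).summable_iff.2 hs) fun x => ?_
  rw [norm_mul, norm_pow, norm_div, norm_one, Complex.norm_natCast]
  refine mul_le_of_le_one_left (by positivity) ?_
  rw [div_le_one (by positivity)]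
  exact_mod_cast Nat.succ_le_succ (Nat.zero_le _)

/-- The logarithm of the infinite product `∏ (1 - r k)` as a double series. -/
theorem tendsto_prod_one_sub {r : ℕ → ℂ} (hr : Summable fun k => ‖r k‖)
    (h1 : ∀ k, ‖r k‖ < 1) :
    Tendsto (fun n => ∏ k ∈ Finset.range n, (1 - r k)) atTop
      (𝓝 (Complex.exp (-∑' x : ℕ × ℕ, 1 / ((x.1 + 1 : ℕ) : ℂ) * r x.2 ^ (x.1 + 1)))) := by
  have hs := (Equiv.prodComm ℕ ℕ).hasSum_iff.2 (summable_pow_succ_div hr h1).hasSum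
  -- Summing over the exponent first gives the principal logarithm of each factor; exponentiating
  -- the partial sums removes any question of branches.
  have hk := hs.prod_fiberwise (g := fun k => -Complex.log (1 - r k)) fun k => by
    refine (Complex.hasSum_taylorSeries_neg_log' (h1 k)).congr_fun fun p => ?_
    simp [div_eq_inv_mul]
  refine (hk.tendsto_sum_nat.neg.cexp).congr fun n => ?_
  rw [← Finset.sum_neg_distrib, Complex.exp_sum]
  refine Finset.prod_congr rfl fun k _ => ?_
  rw [neg_neg, Complex.exp_log]
  intro h0
  have := h1 k
  rw [← sub_eq_zero.1 h0, norm_one] at this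
  exact this.false

/-- The ratio `(sin πv / sin (k + 1/2)πt)²`. -/
noncomputable def sinRatio (v t : ℂ) (k : ℕ) : ℂ :=
  Complex.sin (Real.pi * v) ^ 2 * (1 / Complex.sin (((k : ℂ) + 1 / 2) * Real.pi * t) ^ 2)

theorem sinRatio_pow (v t : ℂ) (k p : ℕ) :
    sinRatio v t k ^ p = Complex.sin (Real.pi * v) ^ (2 * p) *
    (1 / Complex.sin (((k : ℂ) + 1 / 2) * Real.pi * t) ^ (2 * p)) := by
  rw [sinRatio, mul_pow, one_div_pow, ← pow_mul, ← pow_mul]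

theorem summable_norm_sinRatio (v : ℂ) {t : ℂ} (ht : 0 < t.im) :
    Summable fun k => ‖sinRatio v t k‖ := by
  simp only [sinRatio, norm_mul]
  exact (summable_norm_inv_sin_half_sq ht).mul_left _

theorem norm_sinRatio_lt_one {v t : ℂ} (h : InStrip v t) (k : ℕ) : ‖sinRatio v t k‖ < 1 := by
  have hk := h k
  rw [sinRatio, mul_one_div, ← div_pow, norm_pow, norm_div]
  exact pow_lt_one₀ (by positivity)
    ((div_lt_one ((norm_nonneg _).trans_lt hk)).2 hk) two_ne_zero

/-- Both sides equal `(1 - Q^(2k+1))² + 4 Q^(2k+1) sin² πv`, where `Q` is the nome. The square does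
not depend on `v`, so it belongs to `θ₄(0, t)`. -/
theorem theta4_factor (v : ℂ) {t : ℂ} (ht : 0 < t.im) (k : ℕ) :
    1 + nome t ^ (4 * k + 2) - nome t ^ (2 * k + 1) *
        (Complex.exp (2 * Real.pi * Complex.I * v) +
          (Complex.exp (2 * Real.pi * Complex.I * v))⁻¹) =
      (1 - nome t ^ (2 * k + 1)) ^ 2 * (1 - sinRatio v t k) := by
  have h1 := one_sub_nome_pow_ne_zero ht k
  have hv := four_mul_sin_pi_sq v
  rw [sinRatio, inv_sin_half_sq ht, eq_sub_of_add_eq (eq_sub_iff_add_eq'.1 hv),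
    show 4 * k + 2 = (2 * k + 1) * 2 by ring, pow_mul]
  field_simp
  ring

/-- The logarithm of the theta function `θ₄`, as a double series. -/
noncomputable def logTheta4 (v t : ℂ) : ℂ :=
  ∑' x : ℕ × ℕ, 1 / ((x.1 + 1 : ℕ) : ℂ) * sinRatio v t x.2 ^ (x.1 + 1)

theorem hasSum_logTheta4 {v t : ℂ} (ht : 0 < t.im) (hv : InStrip v t) :
    HasSum (fun x : ℕ × ℕ => 1 / ((x.1 + 1 : ℕ) : ℂ) * sinRatio v t x.2 ^ (x.1 + 1))
      (logTheta4 v t) :=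
  (summable_pow_succ_div (summable_norm_sinRatio v ht) (norm_sinRatio_lt_one hv)).hasSum

theorem theta4_eq {v t : ℂ} (ht : 0 < t.im) (hv : InStrip v t) :
    theta4 v t = theta4 0 t * Complex.exp (-logTheta4 v t) := by
  have hx : ‖nome t ^ 2‖ < 1 := by
    rw [norm_pow]; exact pow_lt_one₀ (norm_nonneg _) (norm_nome_lt_one ht) two_ne_zero
  have hlim := tendsto_prod_theta4 v ht
  have hlim0 := tendsto_prod_theta4 0 ht
  simp only [theta4_factor _ ht] at hlim hlim0
  simp only [Finset.prod_mul_distrib] at hlim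
  have hr : ∀ k, sinRatio 0 t k = 0 := fun k => by simp [sinRatio]
  simp only [hr, sub_zero, mul_one] at hlim0
  have h := tendsto_nhds_unique hlim (hlim0.mul
    (tendsto_prod_one_sub (summable_norm_sinRatio v ht) (norm_sinRatio_lt_one hv)))
  rw [mul_right_comm] at h
  exact mul_right_cancel₀ (inv_ne_zero (eulerProdInf_ne_zero hx)) h

/-- The double series summed over `k` first; absolute convergence permits the iterated sum. -/
theorem hasSum_thetaCoeff {v t : ℂ} (ht : 0 < t.im) (hv : InStrip v t) :
    HasSum (fun p : ℕ => thetaCoeff (p + 1) t * Complex.sin (Real.pi * v) ^ (2 * (p + 1)))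
      (-logTheta4 v t) := by
  have h := (hasSum_logTheta4 ht hv).prod_fiberwise fun p =>
    (((summable_inv_sin_half_pow ht (Nat.succ_le_succ (Nat.zero_le p))).hasSum.mul_left
      (Complex.sin (Real.pi * v) ^ (2 * (p + 1)))).mul_left
        (1 / ((p + 1 : ℕ) : ℂ))).congr_fun fun k => by simp only [sinRatio_pow]
  refine h.neg.congr_fun fun p => ?_
  rw [thetaCoeff]
  ring

/-! ### The expansions of `R` in sines and in powers of `q`. -/

theorem sinRatio_five {v τ z : ℂ} (hτ : 0 < τ.im)
    (hz : Complex.exp (2 * Real.pi * Complex.I * v) = z) (k : ℕ) :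
    sinRatio v (5 * τ) k =
      nome τ ^ (5 * (2 * k + 1)) * ((1 - z) ^ 2 / z) / (nome τ ^ (5 * (2 * k + 1)) - 1) ^ 2 := by
  have ht : 0 < (5 * τ).im := by simpa using hτ
  have h5 : nome (5 * τ) = nome τ ^ 5 := by exact_mod_cast nome_nat_mul 5 τ
  have hv := four_mul_sin_pi_sq v
  have hz0 : z ≠ 0 := hz ▸ Complex.exp_ne_zero _
  rw [hz] at hv
  rw [sinRatio, inv_sin_half_sq ht, h5, ← pow_mul, ← neg_sub 1 (nome τ ^ _), neg_sq, ← mul_div_assoc]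
  congr 1
  rw [show (1 - z) ^ 2 / z = -(4 * Complex.sin (Real.pi * v) ^ 2) by rw [hv]; field_simp; ring]
  ring

theorem R_eq_exp {τ : ℂ} (hτ : 0 < τ.im) (h1 : InStrip (τ / 2) (5 * τ))
    (h3 : InStrip (3 * τ / 2) (5 * τ)) :
    R τ = nomeTwoFifths τ *
      Complex.exp (logTheta4 (τ / 2) (5 * τ) - logTheta4 (3 * τ / 2) (5 * τ)) := by
  have ht : 0 < (5 * τ).im := by simpa using hτ
  have h0 := theta4_half_ne_zero hτ
  rw [R_eq hτ, theta4_eq ht h3]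
  rw [theta4_eq ht h1] at h0 ⊢
  -- The factor `θ₄(0, 5τ)` cancels; it is nonzero because it divides `θ₄(τ/2, 5τ) ≠ 0`.
  rw [mul_div_mul_left _ _ (left_ne_zero_of_mul h0), ← Complex.exp_sub]
  ring_nf

theorem hasSum_logTheta4_sub {τ : ℂ} (hτ : 0 < τ.im) (h1 : InStrip (τ / 2) (5 * τ))
    (h3 : InStrip (3 * τ / 2) (5 * τ)) :
    HasSum (fun x : ℕ × ℕ => 1 / ((x.1 + 1 : ℕ) : ℂ) * (sinRatio (τ / 2) (5 * τ) x.2 ^ (x.1 + 1) -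
      sinRatio (3 * τ / 2) (5 * τ) x.2 ^ (x.1 + 1)))
      (logTheta4 (τ / 2) (5 * τ) - logTheta4 (3 * τ / 2) (5 * τ)) := by
  have ht : 0 < (5 * τ).im := by simpa using hτ
  simpa only [mul_sub] using (hasSum_logTheta4 ht h1).sub (hasSum_logTheta4 ht h3)

theorem sinRatio_half {τ : ℂ} (hτ : 0 < τ.im) (k : ℕ) : sinRatio (τ / 2) (5 * τ) k =
    nome τ ^ (2 * (5 * k + 1)) * (nome τ ^ 2 - nome τ) ^ 2 /
      (nome τ ^ (5 * (2 * k + 1)) - 1) ^ 2 := by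
  have hq := nome_ne_zero τ
  rw [sinRatio_five hτ (z := nome τ) (by rw [nome]; ring_nf)]
  congr 1
  field_simp
  ring

theorem sinRatio_three_half {τ : ℂ} (hτ : 0 < τ.im) (k : ℕ) : sinRatio (3 * τ / 2) (5 * τ) k =
    nome τ ^ (2 * (5 * k + 1)) * (nome τ ^ 3 - 1) ^ 2 /
      (nome τ ^ (5 * (2 * k + 1)) - 1) ^ 2 := by
  have hq := nome_ne_zero τ
  rw [sinRatio_five hτ (z := nome τ ^ 3)
    (by rw [nome, ← Complex.exp_nat_mul]; push_cast; ring_nf)]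
  congr 1
  field_simp
  ring

end RogersRamanujan

theorem mainTheorem3 (τ : ℂ) (hτ : 0 < τ.im) :
    -- the numbers `c_{2p}(5τ)` are well defined, and are the coefficients of the expansion
    -- of `log (θ₄(v, 5τ) / θ₄(0, 5τ))` in powers of `sin πv`
    (∀ p : ℕ, 1 ≤ p → Summable fun k : ℕ =>
      1 / Complex.sin (((k : ℂ) + 1 / 2) * Real.pi * (5 * τ)) ^ (2 * p)) ∧
    (∀ v : ℂ, RogersRamanujan.InStrip v (5 * τ) →
      ∃ S : ℂ,
        HasSum (fun p : ℕ => RogersRamanujan.thetaCoeff (p + 1) (5 * τ) *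
          Complex.sin (Real.pi * v) ^ (2 * (p + 1))) S ∧
        RogersRamanujan.theta4 v (5 * τ) =
          RogersRamanujan.theta4 0 (5 * τ) * Complex.exp S) ∧
    -- the continued fraction converges, and it is a quotient of theta functions
    Tendsto (RogersRamanujan.contFract τ).convs atTop (𝓝 (RogersRamanujan.R τ)) ∧
    RogersRamanujan.theta4 (τ / 2) (5 * τ) ≠ 0 ∧
    RogersRamanujan.R τ = RogersRamanujan.nomeTwoFifths τ *
      (RogersRamanujan.theta4 (3 * τ / 2) (5 * τ) / RogersRamanujan.theta4 (τ / 2) (5 * τ)) ∧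
    -- the three expansions of the continued fraction, with `p + 1` in the place of `p ≥ 1`
    (RogersRamanujan.InStrip (τ / 2) (5 * τ) → RogersRamanujan.InStrip (3 * τ / 2) (5 * τ) →
      (∃ S : ℂ,
        HasSum (fun p : ℕ => RogersRamanujan.thetaCoeff (p + 1) (5 * τ) *
          (Complex.sin (Real.pi * τ / 2) ^ (2 * (p + 1)) -
            Complex.sin (3 * Real.pi * τ / 2) ^ (2 * (p + 1)))) S ∧
        RogersRamanujan.R τ = Complex.exp (Complex.I * Real.pi * (2 * τ / 5) - S)) ∧
      (∃ S : ℂ,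
        HasSum (fun x : ℕ × ℕ => 1 / ((x.1 + 1 : ℕ) : ℂ) *
          ((Complex.sin (Real.pi * τ / 2) ^ (2 * (x.1 + 1)) -
            Complex.sin (3 * Real.pi * τ / 2) ^ (2 * (x.1 + 1))) /
            Complex.sin (((x.2 : ℂ) + 1 / 2) * (5 * Real.pi * τ)) ^ (2 * (x.1 + 1)))) S ∧
        RogersRamanujan.R τ = Complex.exp (Complex.I * Real.pi * (2 * τ / 5) + S)) ∧
      (∃ S : ℂ,
        HasSum (fun x : ℕ × ℕ =>
          RogersRamanujan.nome τ ^ (2 * (x.1 + 1) * (5 * x.2 + 1)) / ((x.1 + 1 : ℕ) : ℂ) *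
          (((RogersRamanujan.nome τ ^ 2 - RogersRamanujan.nome τ) ^ (2 * (x.1 + 1)) -
            (RogersRamanujan.nome τ ^ 3 - 1) ^ (2 * (x.1 + 1))) /
            (RogersRamanujan.nome τ ^ (5 * (2 * x.2 + 1)) - 1) ^ (2 * (x.1 + 1)))) S ∧
        RogersRamanujan.R τ = RogersRamanujan.nomeTwoFifths τ * Complex.exp S)) := by
  have ht : 0 < (5 * τ).im := by simpa using hτ
  have hR := RogersRamanujan.R_eq hτ
  refine ⟨fun p hp => RogersRamanujan.summable_inv_sin_half_pow ht hp, fun v hv =>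
    ⟨_, RogersRamanujan.hasSum_thetaCoeff ht hv, RogersRamanujan.theta4_eq ht hv⟩,
    hR ▸ RogersRamanujan.tendsto_convs hτ, RogersRamanujan.theta4_half_ne_zero hτ, hR,
    fun h1 h3 => ?_⟩
  have hexp := RogersRamanujan.R_eq_exp hτ h1 h3
  have hsum := RogersRamanujan.hasSum_logTheta4_sub hτ h1 h3
  have e1 : Real.pi * τ / 2 = Real.pi * (τ / 2) := mul_div_assoc _ _ _
  have e3 : 3 * Real.pi * τ / 2 = Real.pi * (3 * τ / 2) := by ring
  -- The first sum is the negative of the other two, since `thetaCoeff` carries the minus sign and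
  -- `logTheta4` is in fact `-log (θ₄(v, t) / θ₄(0, t))`.
  refine ⟨⟨-(RogersRamanujan.logTheta4 (τ / 2) (5 * τ) -
    RogersRamanujan.logTheta4 (3 * τ / 2) (5 * τ)), ?_, ?_⟩, ⟨RogersRamanujan.logTheta4 (τ / 2) (5 * τ) -
    RogersRamanujan.logTheta4 (3 * τ / 2) (5 * τ), ?_, ?_⟩, ⟨_, ?_, hexp⟩⟩
  · have h := (RogersRamanujan.hasSum_thetaCoeff ht h1).sub
      (RogersRamanujan.hasSum_thetaCoeff ht h3)
    rw [show ∀ a b : ℂ, -a - -b = -(a - b) by intros; ring] at h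
    refine h.congr_fun fun p => ?_
    rw [mul_sub, e1, e3]
  · rw [hexp, sub_neg_eq_add, Complex.exp_add]; rfl
  · refine hsum.congr_fun fun x => ?_
    rw [RogersRamanujan.sinRatio_pow, RogersRamanujan.sinRatio_pow, e1, e3,
      show ((x.2 : ℂ) + 1 / 2) * (5 * Real.pi * τ) = ((x.2 : ℂ) + 1 / 2) * Real.pi * (5 * τ) by ring]
    ring
  · rw [hexp, Complex.exp_add]; rfl
  · refine hsum.congr_fun fun x => ?_
    rw [RogersRamanujan.sinRatio_half hτ, RogersRamanujan.sinRatio_three_half hτ, div_pow, div_pow,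
      mul_pow, mul_pow, ← pow_mul, ← pow_mul, ← pow_mul, ← pow_mul,
      show 2 * (x.1 + 1) * (5 * x.2 + 1) = 2 * (5 * x.2 + 1) * (x.1 + 1) by ring]
    ring
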